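/- Let $r\ge 1$ and $n\ge 2r$ be integers and put $m=\lfloor n/r\rfloor$. For $p,q\in[m]$ let ${\bf M}_{p,q}$ denote the $r\times r$ block of an $n\times n$ matrix ${\bf M}$ at block position $(p,q)$ in its first $mr$ rows and columns. A block sparsity graph $\mathcal{G}=(\mathcal{G}_1,\mathcal{G}_2)=([m],\mathcal{E}_1,\mathcal{E}_2)$ is a pair of undirected graphs on $[m]$, self-loops allowed, with disjoint edge sets. It induces the set $\Omega(\mathcal{G})\subset[n]\times[n]$ of observed index pairs that consists of all positions in the last $n-mr$ rows and columns, all positions of the block $(p,q)$ if $(p,q)\in\mathcal{E}_1$, and the nondiagonal positions of the block $(p,q)$ if $(p,q)\in\mathcal{E}_2$. The class $\mathcal{L}(\mathcal{G},n,r)$ consists of the matrix completion problems $({\bf M}^*,\Omega)$ such that ${\bf M}^*\in\mathbb{R}^{n\times n}$ is positive semidefinite of rank $r$, every block ${\bf M}^*_{p,q}$, $p,q\in[m]$, has rank $r$, $\Omega=\Omega(\mathcal{G})$, and $\mathcal{G}_1$ is connected and non-bipartite. A spurious solution of such a problem is a local minimum ${\bf X}$ over $\mathbb{R}^{n\times r}$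 of $$f({\bf X})=\left\|({\bf X}{\bf X}^T-{\bf M}^*)_\Omega\right\|_F^2$$ (entries outside $\Omega$ being replaced by $0$) whose value $f({\bf X})$ is not the global minimum value. Two matrices ${\bf X},{\bf Y}\in\mathbb{R}^{n\times r}$ are equivalent if ${\bf Y}={\bf X}{\bf Q}$ for an orthogonal $r\times r$ matrix ${\bf Q}$. (i) There are a block sparsity graph $\mathcal{G}$ and an instance in $\mathcal{L}(\mathcal{G},n,r)$ with at least $2^{r\lfloor n/r\rfloor-2r}-1$ equivalence classes of spurious solutions; when $r$ divides $n$ this number is $2^{n-2r}-1$. (ii) If $n\ge 3r$, there are a block sparsity graph $\mathcal{G}$ and an instance in $\mathcal{L}(\mathcal{G},n,r)$ with $|\Omega|=n^2-2r$ that has spurious solutions. -/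

import Mathlib

/-- A symmetric matrix completion problem of size `n` and rank `r`: a ground truth matrix together
with the set of index pairs whose entries are observed. -/
structure MCProblem (n r : ℕ) where
  /-- the ground truth matrix -/
  groundTruth : Matrix (Fin n) (Fin n) ℝ
  /-- the set of observed (ordered) index pairs -/
  observed : Set (Fin n × Fin n)

/-- A block sparsity graph on the vertices `Fin m`: two undirected graphs, with self-loops allowed,
given by disjoint sets of unordered pairs. -/
structure BlockSparsityGraph (m : ℕ) where
  /-- edges of the first graph: the whole block is observed -/
  E₁ : Set (Sym2 (Fin m))
  /-- edges of the second graph: the nondiagonal entries of the block are observed -/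
  E₂ : Set (Sym2 (Fin m))
  disjoint : Disjoint E₁ E₂

namespace BlockSparsityGraph

/-- The first graph is connected (self-loops are irrelevant for this and are discarded by
`SimpleGraph.fromEdgeSet`). -/
def Connected₁ {m : ℕ} (G : BlockSparsityGraph m) : Prop :=
  (SimpleGraph.fromEdgeSet G.E₁).Connected

/-- The first graph is bipartite: its vertices can be coloured with two colours so that the two ends
of every edge have different colours. In particular a graph with a self-loop is not bipartite. -/
def Bipartite₁ {m : ℕ} (G : BlockSparsityGraph m) : Prop :=
  ∃ c : Fin m → Bool, ∀ i j : Fin m, s(i, j) ∈ G.E₁ → c i ≠ c j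

end BlockSparsityGraph

/-- The row (or column) of an `n × n` matrix at position `a` of the `p`-th group of `r` consecutive
rows, where `p < ⌊n / r⌋`. -/
def blockIndex {n r : ℕ} (p : Fin (n / r)) (a : Fin r) : Fin n :=
  ⟨p.1 * r + a.1, by
    have h1 : (p.1 + 1) * r ≤ n / r * r := Nat.mul_le_mul_right r p.2
    have h2 : n / r * r ≤ n := Nat.div_mul_le_self n r
    have h3 := a.2
    rw [Nat.add_mul] at h1
    omega⟩

/-- The `r × r` block of `M` at block position `(p, q)`. -/
def matrixBlock {n r : ℕ} (M : Matrix (Fin n) (Fin n) ℝ) (p q : Fin (n / r)) :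
    Matrix (Fin r) (Fin r) ℝ :=
  M.submatrix (blockIndex p) (blockIndex q)

/-- The measurement set induced by a block sparsity graph: the last `n - ⌊n / r⌋ * r` rows and
columns, all entries of the blocks in `E₁`, and all nondiagonal entries of the blocks in `E₂`. -/
def inducedMeasurementSet {n r : ℕ} (G : BlockSparsityGraph (n / r)) : Set (Fin n × Fin n) :=
  {e | n / r * r ≤ e.1.1 ∨ n / r * r ≤ e.2.1 ∨
    ∃ (p q : Fin (n / r)) (a b : Fin r), e = (blockIndex p a, blockIndex q b) ∧
      (s(p, q) ∈ G.E₁ ∨ (s(p, q) ∈ G.E₂ ∧ a ≠ b))}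

/-- The low-complexity class `𝓛(G, n, r)` of matrix completion problems. -/
structure LowComplexity {n r : ℕ} (G : BlockSparsityGraph (n / r)) (P : MCProblem n r) : Prop where
  posSemidef : P.groundTruth.PosSemidef
  rank_eq : P.groundTruth.rank = r
  block_rank : ∀ p q : Fin (n / r), (matrixBlock P.groundTruth p q).rank = r
  observed_eq : P.observed = inducedMeasurementSet G
  connected : G.Connected₁
  not_bipartite : ¬ G.Bipartite₁

namespace MCProblem

open Classical in
/-- The measurement operator: unobserved entries are replaced by zero. -/
noncomputable def measure {n r : ℕ} (P : MCProblem n r) (M : Matrix (Fin n) (Fin n) ℝ) :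
    Matrix (Fin n) (Fin n) ℝ :=
  Matrix.of fun i j => if (i, j) ∈ P.observed then M i j else 0

/-- The Burer-Monteiro objective with the `ℓ₂` loss, `‖(X Xᵀ - M*)_Ω‖_F ^ 2`. -/
noncomputable def objective {n r : ℕ} (P : MCProblem n r) (X : Matrix (Fin n) (Fin r) ℝ) : ℝ :=
  ∑ i, ∑ j, (P.measure (X * X.transpose - P.groundTruth) i j) ^ 2

/-- A spurious solution: a local minimum whose objective value is not the optimal one. -/
def IsSpurious {n r : ℕ} (P : MCProblem n r) (X : Matrix (Fin n) (Fin r) ℝ) : Prop :=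
  IsLocalMin P.objective X ∧ ∃ Y : Matrix (Fin n) (Fin r) ℝ, P.objective Y < P.objective X

end MCProblem

/-- Two factors are equivalent when they differ by an orthogonal transformation on the right. -/
def factorSetoid (n r : ℕ) : Setoid (Matrix (Fin n) (Fin r) ℝ) where
  r X Y := ∃ Q ∈ Matrix.orthogonalGroup (Fin r) ℝ, Y = X * Q
  iseqv :=
    { refl := fun X => ⟨1, one_mem _, by simp⟩
      symm := by
        rintro X Y ⟨Q, hQ, rfl⟩
        refine ⟨star Q, Unitary.star_mem hQ, ?_⟩
        rw [Matrix.mul_assoc, Unitary.mul_star_self_of_mem hQ, Matrix.mul_one]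
      trans := by
        rintro X Y Z ⟨Q, hQ, rfl⟩ ⟨Q', hQ', rfl⟩
        exact ⟨Q * Q', mul_mem hQ hQ', by rw [Matrix.mul_assoc]⟩ }

/-- The set of equivalence classes, in `ℝ^(n × r) / O(r)`, of spurious solutions. -/
def MCProblem.spuriousClasses {n r : ℕ} (P : MCProblem n r) : Set (Quotient (factorSetoid n r)) :=
  Quotient.mk (factorSetoid n r) '' {X | P.IsSpurious X}

/-! Fix a proper nonempty set `S` of blocks. Let `𝓖₂` consist of the pairs of distinct blocks in
`S` and `𝓖₁` of all remaining pairs, loops included, and let the ground truth be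
`M_ε = Z_ε Z_εᵀ`, where `Z_ε` stacks the block `1` over `S`, the block `ε • 1` outside `S`, and zero
in the trailing rows. The unobserved positions are exactly the diagonals of the blocks `(p, q)` with
`p ≠ q` in `S`. For `ε ≠ 0` a block outside `S` ties all the blocks of `S` together and `M_ε` is the
only completion. For `ε = 0` this tie is lost, and every diagonal sign matrix in each block of `S`
gives a completion.

These completions survive, for small `ε`, as local minima. Given signs `σ p a`, consider the closed
set of factors `X` for which every entry `(X Xᵀ)_{(p,a),(q,a)}`, `p, q ∈ S`, is zero or has the sign
`σ p a * σ q a`. All diagonal entries are observed, so sublevel sets are bounded and a minimizer over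
this set exists. A factor attaining value zero at `ε = 0` has none of these entries equal to zero
(`corr_ne_zero_of_objective_eq_zero`); by compactness, for small `ε` the minimizer has none either,
so it lies in the interior and is a local minimum (`eventually_exists_isLocalMin`). If `σ` is not
constant along `S`, the value there is not zero, because a factor of value zero has
`(X Xᵀ)_{(p,a),(q,a)} = 1` (`corr_eq_one_of_objective_eq_zero`).

The numbers `(X Xᵀ)_{(p,a),(q,a)}` do not change when `X` is multiplied by an orthogonal matrix, so
sign patterns normalized to be `1` on a chosen block of `S` give inequivalent local minima. Taking
`S` to be all blocks but one leaves `2 ^ (r * (m - 2))` normalized patterns, of which only the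
constant one is not spurious. Taking `S` to be two of at least three blocks leaves only `2 * r`
entries unobserved. -/

open Filter Topology Matrix

namespace CompletionInstance

variable {n r : ℕ}

/-! ### Block indices and stacked diagonal factors -/

theorem blockIndex_inj {p q : Fin (n / r)} {a b : Fin r} :
    (blockIndex p a : Fin n) = blockIndex q b ↔ p = q ∧ a = b := by
  refine ⟨fun h => ?_, by rintro ⟨rfl, rfl⟩; rfl⟩
  have hr : 0 < r := a.pos
  have h' : p.1 * r + a.1 = q.1 * r + b.1 := congrArg Fin.val h
  have hdiv := congrArg (· / r) h'
  have hmod := congrArg (· % r) h'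
  simp only [Nat.mul_add_mod_self_right, Nat.mod_eq_of_lt a.2, Nat.mod_eq_of_lt b.2,
    Nat.add_div_of_dvd_right (Dvd.intro_left _ rfl), Nat.mul_div_cancel _ hr,
    Nat.div_eq_of_lt a.2, Nat.div_eq_of_lt b.2] at hdiv hmod
  exact ⟨Fin.ext (by simpa using hdiv), Fin.ext hmod⟩

theorem blockIndex_lt (p : Fin (n / r)) (a : Fin r) : (blockIndex p a : Fin n).1 < n / r * r := by
  have h1 : (p.1 + 1) * r ≤ n / r * r := Nat.mul_le_mul_right r p.2
  have h3 := a.2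
  rw [Nat.add_mul] at h1
  change p.1 * r + a.1 < _
  omega

theorem exists_blockIndex {i : Fin n} (hi : i.1 < n / r * r) :
    ∃ (p : Fin (n / r)) (a : Fin r), i = blockIndex p a := by
  have hr : 0 < r := Nat.pos_of_ne_zero (by rintro rfl; simp at hi)
  exact ⟨⟨i.1 / r, (Nat.div_lt_iff_lt_mul hr).2 hi⟩, ⟨i.1 % r, Nat.mod_lt _ hr⟩,
    Fin.ext (Nat.div_add_mod' _ _).symm⟩

/-- The factor whose block `p` is the diagonal matrix with entries `s p a`, with zero trailing
rows. -/
def stack (s : Fin (n / r) → Fin r → ℝ) : Matrix (Fin n) (Fin r) ℝ :=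
  fun i b => ∑ p, if i = blockIndex p b then s p b else 0

theorem stack_blockIndex (s : Fin (n / r) → Fin r → ℝ) (p : Fin (n / r)) (a b : Fin r) :
    (stack s : Matrix (Fin n) (Fin r) ℝ) (blockIndex p a) b = if a = b then s p a else 0 := by
  by_cases h : a = b
  · subst h
    simp [stack, blockIndex_inj]
  · simp [stack, blockIndex_inj, h]

theorem stack_of_le (s : Fin (n / r) → Fin r → ℝ) {i : Fin n} (hi : n / r * r ≤ i.1) (b : Fin r) :
    (stack s : Matrix (Fin n) (Fin r) ℝ) i b = 0 :=
  Finset.sum_eq_zero fun p _ => if_neg fun h => by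
    have := blockIndex_lt p b
    rw [← h] at this
    omega

theorem stack_mul_transpose (s t : Fin (n / r) → Fin r → ℝ) (p q : Fin (n / r)) (a b : Fin r) :
    ((stack s : Matrix (Fin n) (Fin r) ℝ) * (stack t)ᵀ) (blockIndex p a) (blockIndex q b) =
      if a = b then s p a * t q a else 0 := by
  by_cases h : a = b
  · subst h
    simp [Matrix.mul_apply, stack_blockIndex]
  · simp [Matrix.mul_apply, stack_blockIndex, h]

/-! ### The instance -/

/-- Every pair of distinct blocks in `S` is an edge of the second graph, and every other pair,
loops included, is an edge of the first. -/
def graph (S : Finset (Fin (n / r))) : BlockSparsityGraph (n / r) where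
  E₁ := {e | ∃ p ∈ S, ∃ q ∈ S, p ≠ q ∧ e = s(p, q)}ᶜ
  E₂ := {e | ∃ p ∈ S, ∃ q ∈ S, p ≠ q ∧ e = s(p, q)}
  disjoint := disjoint_compl_left

theorem mem_graph_E₂ {S : Finset (Fin (n / r))} {p q : Fin (n / r)} :
    s(p, q) ∈ (graph S).E₂ ↔ p ∈ S ∧ q ∈ S ∧ p ≠ q := by
  constructor
  · rintro ⟨p', hp, q', hq, hne, h⟩
    rcases Sym2.eq_iff.1 h with ⟨rfl, rfl⟩ | ⟨rfl, rfl⟩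
    · exact ⟨hp, hq, hne⟩
    · exact ⟨hq, hp, hne.symm⟩
  · rintro ⟨hp, hq, hne⟩
    exact ⟨p, hp, q, hq, hne, rfl⟩

theorem mem_graph_E₁ {S : Finset (Fin (n / r))} {p q : Fin (n / r)} :
    s(p, q) ∈ (graph S).E₁ ↔ ¬(p ∈ S ∧ q ∈ S ∧ p ≠ q) :=
  mem_graph_E₂.not

/-- The unobserved positions are the diagonals of the blocks between distinct members of `S`. -/
theorem mem_inducedMeasurementSet_graph {S : Finset (Fin (n / r))} {e : Fin n × Fin n} :
    e ∈ inducedMeasurementSet (graph S) ↔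
      ¬∃ p ∈ S, ∃ q ∈ S, ∃ a : Fin r, p ≠ q ∧ e = (blockIndex p a, blockIndex q a) := by
  obtain ⟨i, j⟩ := e
  constructor
  · rintro h ⟨p, hp, q, hq, a, hne, he⟩
    obtain ⟨rfl, rfl⟩ := Prod.ext_iff.1 he
    rcases h with h | h | ⟨p', q', a', b', he', h⟩
    · exact absurd h (blockIndex_lt p a).not_ge
    · exact absurd h (blockIndex_lt q a).not_ge
    · obtain ⟨h1, h2⟩ := Prod.ext_iff.1 he'
      obtain ⟨rfl, rfl⟩ := blockIndex_inj.1 h1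
      obtain ⟨rfl, rfl⟩ := blockIndex_inj.1 h2
      rcases h with h | h
      · exact mem_graph_E₁.1 h ⟨hp, hq, hne⟩
      · exact h.2 rfl
  · intro h
    by_cases hi : n / r * r ≤ i.1
    · exact Or.inl hi
    by_cases hj : n / r * r ≤ j.1
    · exact Or.inr (Or.inl hj)
    obtain ⟨p, a, rfl⟩ := exists_blockIndex (not_le.1 hi)
    obtain ⟨q, b, rfl⟩ := exists_blockIndex (not_le.1 hj)
    refine Or.inr (Or.inr ⟨p, q, a, b, rfl, ?_⟩)
    by_cases hpq : p ∈ S ∧ q ∈ S ∧ p ≠ q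
    · refine Or.inr ⟨mem_graph_E₂.2 hpq, ?_⟩
      rintro rfl
      exact h ⟨p, hpq.1, q, hpq.2.1, a, hpq.2.2, rfl⟩
    · exact Or.inl (mem_graph_E₁.2 hpq)

/-- The scale of block `p` in the ground truth factor: `1` on `S` and `ε` elsewhere. -/
def scale (S : Finset (Fin (n / r))) (ε : ℝ) (p : Fin (n / r)) (_ : Fin r) : ℝ :=
  if p ∈ S then 1 else ε

/-- The completion problem with ground truth `Z Zᵀ`, where `Z` has block `1` over `S` and block
`ε • 1` elsewhere. -/
def problem (S : Finset (Fin (n / r))) (ε : ℝ) : MCProblem n r where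
  groundTruth := stack (scale S ε) * (stack (scale S ε))ᵀ
  observed := inducedMeasurementSet (graph S)

theorem groundTruth_blockIndex (S : Finset (Fin (n / r))) (ε : ℝ) (p q : Fin (n / r))
    (a b : Fin r) : (problem S ε).groundTruth (blockIndex p a) (blockIndex q b) =
      if a = b then (if p ∈ S then 1 else ε) * (if q ∈ S then 1 else ε) else 0 :=
  stack_mul_transpose ..

theorem lowComplexity {S : Finset (Fin (n / r))} {o : Fin (n / r)} (ho : o ∉ S) {ε : ℝ}
    (hε : ε ≠ 0) : LowComplexity (graph S) (problem S ε : MCProblem n r) := by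
  have hblock : ∀ p q : Fin (n / r),
      (matrixBlock (problem S ε : MCProblem n r).groundTruth p q).rank = r := by
    intro p q
    have h : matrixBlock (problem S ε).groundTruth p q =
        ((if p ∈ S then 1 else ε) * (if q ∈ S then 1 else ε)) • (1 : Matrix (Fin r) (Fin r) ℝ) := by
      ext a b
      rw [matrixBlock, Matrix.submatrix_apply, groundTruth_blockIndex]
      simp [Matrix.one_apply]
    rw [h, Matrix.rank_of_isUnit, Fintype.card_fin]
    have hs : ((if p ∈ S then 1 else ε) * (if q ∈ S then 1 else ε) : ℝ) ≠ 0 := by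
      split_ifs <;> simp [hε]
    exact (isUnit_one (M := Matrix (Fin r) (Fin r) ℝ)).smul (Units.mk0 _ hs)
  refine ⟨?_, le_antisymm ?_ ?_, hblock, rfl, ?_, ?_⟩
  · have := Matrix.posSemidef_self_mul_conjTranspose (stack (scale S ε) : Matrix (Fin n) (Fin r) ℝ)
    rwa [Matrix.conjTranspose_eq_transpose_of_trivial] at this
  · exact (Matrix.rank_mul_le_left _ _).trans (Matrix.rank_le_width _)
  · exact (hblock o o).symm.le.trans (Matrix.rank_submatrix_le _ _ _)
  · have hreach : ∀ p, (SimpleGraph.fromEdgeSet (graph S).E₁).Reachable p o := by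
      intro p
      by_cases hp : p = o
      · rw [hp]
      · exact SimpleGraph.Adj.reachable
          ((SimpleGraph.fromEdgeSet_adj _).2 ⟨mem_graph_E₁.2 fun h => ho h.2.1, hp⟩)
    have : Nonempty (Fin (n / r)) := ⟨o⟩
    exact ⟨fun p q => (hreach p).trans (hreach q).symm⟩
  · rintro ⟨c, hc⟩
    exact hc o o (mem_graph_E₁.2 fun h => ho h.1) rfl

/-- With `S` of size `k`, exactly `r * (k ^ 2 - k)` entries are unobserved. -/
theorem ncard_observed (S : Finset (Fin (n / r))) (ε : ℝ) :
    (problem S ε : MCProblem n r).observed.ncard = n ^ 2 - (S.card * S.card - S.card) * r := by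
  let g : (Fin (n / r) × Fin (n / r)) × Fin r → Fin n × Fin n :=
    fun x => (blockIndex x.1.1 x.2, blockIndex x.1.2 x.2)
  have hg : Function.Injective g := by
    rintro ⟨⟨p, q⟩, a⟩ ⟨⟨p', q'⟩, a'⟩ h
    obtain ⟨h1, h2⟩ := Prod.ext_iff.1 h
    obtain ⟨rfl, rfl⟩ := blockIndex_inj.1 h1
    obtain ⟨rfl, -⟩ := blockIndex_inj.1 h2
    rfl
  have hcompl : (problem S ε : MCProblem n r).observed =
      ((((S.offDiag ×ˢ Finset.univ).map ⟨g, hg⟩)ᶜ : Finset (Fin n × Fin n)) : Set _) := by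
    ext e
    refine mem_inducedMeasurementSet_graph.trans ?_
    simp only [Finset.coe_compl, Set.mem_compl_iff, Finset.mem_coe, Finset.mem_map,
      Finset.mem_product, Finset.mem_offDiag, Finset.mem_univ, and_true]
    refine not_congr ⟨?_, ?_⟩
    · rintro ⟨p, hp, q, hq, a, hne, rfl⟩
      exact ⟨((p, q), a), ⟨hp, hq, hne⟩, rfl⟩
    · rintro ⟨⟨⟨p, q⟩, a⟩, ⟨hp, hq, hne⟩, rfl⟩
      exact ⟨p, hp, q, hq, a, hne, rfl⟩
  rw [hcompl, Set.ncard_coe_finset, Finset.card_compl, Finset.card_map, Finset.card_product,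
    Finset.offDiag_card]
  simp [sq]

/-! ### Factors of value zero -/

/-- The diagonal entry `a` of the block `(p, q)` of `X Xᵀ`. -/
def corr (X : Matrix (Fin n) (Fin r) ℝ) (p q : Fin (n / r)) (a : Fin r) : ℝ :=
  (X * Xᵀ) (blockIndex p a) (blockIndex q a)

theorem objective_nonneg (P : MCProblem n r) (X : Matrix (Fin n) (Fin r) ℝ) : 0 ≤ P.objective X :=
  Finset.sum_nonneg fun _ _ => Finset.sum_nonneg fun _ _ => sq_nonneg _

theorem sq_le_objective (P : MCProblem n r) (X : Matrix (Fin n) (Fin r) ℝ) {i j : Fin n}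
    (h : (i, j) ∈ P.observed) :
    ((X * Xᵀ) i j - P.groundTruth i j) ^ 2 ≤ P.objective X := by
  have h1 := Finset.single_le_sum (f := fun j => (P.measure (X * Xᵀ - P.groundTruth) i j) ^ 2)
    (fun _ _ => sq_nonneg _) (Finset.mem_univ j)
  have h2 := Finset.single_le_sum
    (f := fun i => ∑ j, (P.measure (X * Xᵀ - P.groundTruth) i j) ^ 2)
    (fun _ _ => Finset.sum_nonneg fun _ _ => sq_nonneg _) (Finset.mem_univ i)
  have h3 := h1.trans h2
  simpa [MCProblem.objective, MCProblem.measure, h] using h3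

theorem objective_eq_zero_iff (P : MCProblem n r) (X : Matrix (Fin n) (Fin r) ℝ) :
    P.objective X = 0 ↔ ∀ i j, (i, j) ∈ P.observed → (X * Xᵀ) i j = P.groundTruth i j := by
  constructor
  · intro h i j hij
    have h1 := sq_le_objective P X hij
    rw [h] at h1
    exact sub_eq_zero.1 (pow_eq_zero_iff two_ne_zero |>.1 (le_antisymm h1 (sq_nonneg _)))
  · intro h
    refine Finset.sum_eq_zero fun i _ => Finset.sum_eq_zero fun j _ => ?_
    by_cases hij : (i, j) ∈ P.observed
    · simp [MCProblem.measure, h i j hij]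
    · simp [MCProblem.measure, hij]

theorem mul_transpose_apply_eq_of_objective_eq_zero {S : Finset (Fin (n / r))} {ε : ℝ}
    {X : Matrix (Fin n) (Fin r) ℝ} (hX : (problem S ε).objective X = 0) {p q : Fin (n / r)}
    {a b : Fin r} (h : ¬(p ∈ S ∧ q ∈ S ∧ p ≠ q ∧ a = b)) :
    (X * Xᵀ) (blockIndex p a) (blockIndex q b) =
      if a = b then (if p ∈ S then 1 else ε) * (if q ∈ S then 1 else ε) else 0 := by
  rw [← groundTruth_blockIndex]
  refine (objective_eq_zero_iff _ _).1 hX _ _ (mem_inducedMeasurementSet_graph.2 ?_)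
  rintro ⟨p', hp, q', hq, c, hne, he⟩
  obtain ⟨h1, h2⟩ := Prod.ext_iff.1 he
  obtain ⟨rfl, rfl⟩ := blockIndex_inj.1 h1
  obtain ⟨rfl, rfl⟩ := blockIndex_inj.1 h2
  exact h ⟨hp, hq, hne, rfl⟩

/-- The blocks over `S` of a factor of value zero are orthogonal matrices `A`, `B` with `A Bᵀ`
diagonal. A zero diagonal entry would make a whole row of `A Bᵀ`, hence of `A`, vanish. -/
theorem corr_ne_zero_of_objective_eq_zero {S : Finset (Fin (n / r))} {ε : ℝ}
    {X : Matrix (Fin n) (Fin r) ℝ} (hX : (problem S ε).objective X = 0) {p q : Fin (n / r)}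
    (hp : p ∈ S) (hq : q ∈ S) (a : Fin r) : corr X p q a ≠ 0 := by
  intro h0
  let A : Matrix (Fin r) (Fin r) ℝ := X.submatrix (blockIndex p) id
  let B : Matrix (Fin r) (Fin r) ℝ := X.submatrix (blockIndex q) id
  have hB : B * Bᵀ = 1 := by
    ext b c
    have := mul_transpose_apply_eq_of_objective_eq_zero hX (p := q) (q := q) (a := b) (b := c)
      (by tauto)
    exact this.trans (by simp [hq, Matrix.one_apply])
  have hB' : Bᵀ * B = 1 := mul_eq_one_comm.1 hB
  have hrow : (A * Bᵀ) a = 0 := by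
    funext b
    by_cases hab : a = b
    · subst hab
      exact h0
    · have := mul_transpose_apply_eq_of_objective_eq_zero hX (p := p) (q := q) (a := a) (b := b)
        (by tauto)
      exact this.trans (if_neg hab)
  have hA0 : A a = 0 := by
    have h1 : A = A * Bᵀ * B := by rw [Matrix.mul_assoc, hB', Matrix.mul_one]
    rw [h1, Matrix.mul_apply_eq_vecMul, hrow, Matrix.zero_vecMul]
  have h1 := mul_transpose_apply_eq_of_objective_eq_zero hX (p := p) (q := p) (a := a) (b := a)
    (by tauto)
  have h2 : (A * Aᵀ) a a = 0 := by
    rw [Matrix.mul_apply_eq_vecMul, hA0, Matrix.zero_vecMul, Pi.zero_apply]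
  have h3 : (A * Aᵀ) a a = 1 := h1.trans (by simp [hp])
  exact one_ne_zero (h3.symm.trans h2)

/-- A block `o ∉ S` of a factor of value zero is invertible when `ε ≠ 0`, and its products with
the blocks over `S` are known, so the latter all agree. -/
theorem corr_eq_one_of_objective_eq_zero {S : Finset (Fin (n / r))} {o : Fin (n / r)} (ho : o ∉ S)
    {ε : ℝ} (hε : ε ≠ 0) {X : Matrix (Fin n) (Fin r) ℝ} (hX : (problem S ε).objective X = 0)
    {p q : Fin (n / r)} (hp : p ∈ S) (hq : q ∈ S) (a : Fin r) : corr X p q a = 1 := by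
  let A : Fin (n / r) → Matrix (Fin r) (Fin r) ℝ := fun p => X.submatrix (blockIndex p) id
  have hoo : A o * (A o)ᵀ = (ε * ε) • 1 := by
    ext b c
    have := mul_transpose_apply_eq_of_objective_eq_zero hX (p := o) (q := o) (a := b) (b := c)
      (by tauto)
    exact this.trans (by simp [ho, Matrix.one_apply])
  have hS : ∀ p ∈ S, A o * (A p)ᵀ = ε • 1 := by
    intro p hp
    ext b c
    have := mul_transpose_apply_eq_of_objective_eq_zero hX (p := o) (q := p) (a := b) (b := c)
      (by tauto)
    exact this.trans (by simp [ho, hp, Matrix.one_apply])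
  have hinv : A o * ((ε * ε)⁻¹ • (A o)ᵀ) = 1 := by
    rw [Matrix.mul_smul, hoo, smul_smul, inv_mul_cancel₀ (mul_ne_zero hε hε), one_smul]
  have hinv' := mul_eq_one_comm.1 hinv
  have hpq : (A p)ᵀ = (A q)ᵀ := by
    rw [← Matrix.one_mul (A p)ᵀ, ← Matrix.one_mul (A q)ᵀ, ← hinv', Matrix.mul_assoc,
      Matrix.mul_assoc, hS p hp, hS q hq]
  have h1 := mul_transpose_apply_eq_of_objective_eq_zero hX (p := p) (q := p) (a := a) (b := a)
    (by tauto)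
  have h2 : (A p * (A p)ᵀ) a a = 1 := h1.trans (by simp [hp])
  rw [hpq] at h2
  exact h2

/-! ### Local minima with prescribed signs -/

/-- The factors for which `corr X p q a`, with `p, q ∈ S`, is zero or has the sign
`σ p a * σ q a`. -/
def signCell (S : Finset (Fin (n / r))) (σ : Fin (n / r) → Fin r → ℤˣ) :
    Set (Matrix (Fin n) (Fin r) ℝ) :=
  {X | ∀ p ∈ S, ∀ q ∈ S, ∀ a, 0 ≤ ((σ p a * σ q a : ℤˣ) : ℝ) * corr X p q a}

theorem continuous_corr (p q : Fin (n / r)) (a : Fin r) :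
    Continuous fun X : Matrix (Fin n) (Fin r) ℝ => corr X p q a :=
  (continuous_id.matrix_mul continuous_id.matrix_transpose).matrix_elem _ _

theorem isClosed_signCell (S : Finset (Fin (n / r))) (σ : Fin (n / r) → Fin r → ℤˣ) :
    IsClosed (signCell S σ : Set (Matrix (Fin n) (Fin r) ℝ)) := by
  simp only [signCell, Set.ofPred_forall]
  exact isClosed_iInter fun p => isClosed_iInter fun _ => isClosed_iInter fun q =>
    isClosed_iInter fun _ => isClosed_iInter fun a =>
      isClosed_le continuous_const (continuous_const.mul (continuous_corr p q a))

theorem signCell_mem_nhds {S : Finset (Fin (n / r))} {σ : Fin (n / r) → Fin r → ℤˣ}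
    {X : Matrix (Fin n) (Fin r) ℝ}
    (hX : ∀ p ∈ S, ∀ q ∈ S, ∀ a, 0 < ((σ p a * σ q a : ℤˣ) : ℝ) * corr X p q a) :
    signCell S σ ∈ 𝓝 X := by
  have h : ∀ᶠ Y in 𝓝 X, ∀ x : S × S × Fin r,
      0 < ((σ x.1.1 x.2.2 * σ x.2.1.1 x.2.2 : ℤˣ) : ℝ) * corr Y x.1.1 x.2.1.1 x.2.2 :=
    eventually_all.2 fun x =>
      (continuous_const.mul (continuous_corr _ _ _)).continuousAt.eventually
        (lt_mem_nhds (hX _ x.1.2 _ x.2.1.2 _))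
  filter_upwards [h] with Y hY p hp q hq a
  exact (hY (⟨p, hp⟩, ⟨q, hq⟩, a)).le

theorem continuous_objective {α : Type*} [TopologicalSpace α] (S : Finset (Fin (n / r)))
    {ε : α → ℝ} {X : α → Matrix (Fin n) (Fin r) ℝ} (hε : Continuous ε) (hX : Continuous X) :
    Continuous fun z => (problem S (ε z)).objective (X z) := by
  have hstack : Continuous fun z => (stack (scale S (ε z)) : Matrix (Fin n) (Fin r) ℝ) := by
    refine continuous_matrix fun i b => continuous_finsetSum _ fun p _ => ?_
    unfold scale
    split_ifs <;> fun_prop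
  have hM : Continuous fun z => (problem S (ε z) : MCProblem n r).groundTruth :=
    hstack.matrix_mul hstack.matrix_transpose
  have hXX : Continuous fun z => X z * (X z)ᵀ := hX.matrix_mul hX.matrix_transpose
  refine continuous_finsetSum _ fun i _ => continuous_finsetSum _ fun j _ => ?_
  refine Continuous.pow ?_ 2
  by_cases hij : (i, j) ∈ inducedMeasurementSet (graph S)
  · have : ∀ z, (i, j) ∈ (problem S (ε z) : MCProblem n r).observed := fun _ => hij
    simp only [MCProblem.measure, Matrix.of_apply, this, if_true]
    exact (hXX.sub hM).matrix_elem i j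
  · have : ∀ z, (i, j) ∉ (problem S (ε z) : MCProblem n r).observed := fun _ => hij
    simp only [MCProblem.measure, Matrix.of_apply, this, if_false]
    exact continuous_const

/-- The factors with entries in `[-2, 2]`. -/
def box (n r : ℕ) : Set (Matrix (Fin n) (Fin r) ℝ) :=
  Set.pi Set.univ fun _ => Set.pi Set.univ fun _ => Set.Icc (-2) 2

theorem isCompact_box : IsCompact (box n r) :=
  isCompact_univ_pi fun _ => isCompact_univ_pi fun _ => isCompact_Icc

theorem groundTruth_diag_le_one (S : Finset (Fin (n / r))) {ε : ℝ} (hε : |ε| ≤ 1) (i : Fin n) :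
    (problem S ε : MCProblem n r).groundTruth i i ≤ 1 := by
  by_cases hi : n / r * r ≤ i.1
  · simp [problem, Matrix.mul_apply, stack_of_le _ hi]
  · obtain ⟨p, a, rfl⟩ := exists_blockIndex (not_le.1 hi)
    rw [groundTruth_blockIndex, if_pos rfl]
    split_ifs
    · norm_num
    · rw [← sq]
      exact (sq_le_one_iff_abs_le_one ε).2 hε

/-- All diagonal entries are observed, so a small value bounds the norms of the rows. -/
theorem mem_box_of_objective_lt {S : Finset (Fin (n / r))} {ε : ℝ} (hε : |ε| ≤ 1)
    {X : Matrix (Fin n) (Fin r) ℝ} (hX : (problem S ε).objective X < 1) : X ∈ box n r := by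
  intro i _ b _
  have hobs : (i, i) ∈ (problem S ε : MCProblem n r).observed := by
    refine mem_inducedMeasurementSet_graph.2 ?_
    rintro ⟨p, -, q, -, a, hne, he⟩
    obtain ⟨h1, h2⟩ := Prod.ext_iff.1 he
    exact hne (blockIndex_inj.1 (h1.symm.trans h2)).1
  have h1 := (sq_le_objective _ X hobs).trans_lt hX
  have h2 := groundTruth_diag_le_one S hε i
  have h3 : (X * Xᵀ) i i - (problem S ε : MCProblem n r).groundTruth i i < 1 :=
    (abs_lt.1 ((sq_lt_one_iff_abs_lt_one _).1 h1)).2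
  have h4 : X i b * X i b ≤ (X * Xᵀ) i i :=
    Finset.single_le_sum (f := fun b => X i b * X i b) (fun _ _ => mul_self_nonneg _)
      (Finset.mem_univ b)
  exact abs_le.1 (abs_le_of_sq_le_sq (by nlinarith) (by norm_num))

/-- The factor with the diagonal sign matrices `σ p` over `S` and zero elsewhere. -/
def signFactor (S : Finset (Fin (n / r))) (σ : Fin (n / r) → Fin r → ℤˣ) :
    Matrix (Fin n) (Fin r) ℝ :=
  stack fun p a => if p ∈ S then ((σ p a : ℤˣ) : ℝ) else 0

theorem units_mul_self_cast (u : ℤˣ) : ((u : ℤˣ) : ℝ) * ((u : ℤˣ) : ℝ) = 1 := by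
  rcases Int.units_eq_one_or u with rfl | rfl <;> simp

theorem objective_signFactor (S : Finset (Fin (n / r))) (σ : Fin (n / r) → Fin r → ℤˣ) :
    (problem S 0).objective (signFactor S σ : Matrix (Fin n) (Fin r) ℝ) = 0 := by
  refine (objective_eq_zero_iff _ _).2 fun i j hij => ?_
  have hij' := mem_inducedMeasurementSet_graph.1 hij
  by_cases hi : n / r * r ≤ i.1
  · simp [problem, signFactor, Matrix.mul_apply, stack_of_le _ hi]
  by_cases hj : n / r * r ≤ j.1
  · simp [problem, signFactor, Matrix.mul_apply, stack_of_le _ hj]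
  obtain ⟨p, a, rfl⟩ := exists_blockIndex (not_le.1 hi)
  obtain ⟨q, b, rfl⟩ := exists_blockIndex (not_le.1 hj)
  rw [groundTruth_blockIndex, signFactor, stack_mul_transpose]
  by_cases hab : a = b
  · subst hab
    rw [if_pos rfl, if_pos rfl]
    by_cases hp : p ∈ S
    · by_cases hq : q ∈ S
      · obtain rfl : p = q := by
          by_contra hne
          exact hij' ⟨p, hp, q, hq, a, hne, rfl⟩
        simp [hp, units_mul_self_cast]
      · simp [hq]
    · simp [hp]
  · rw [if_neg hab, if_neg hab]

theorem signFactor_mem_signCell (S : Finset (Fin (n / r))) (σ : Fin (n / r) → Fin r → ℤˣ) :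
    (signFactor S σ : Matrix (Fin n) (Fin r) ℝ) ∈ signCell S σ := by
  intro p hp q hq a
  rw [corr, signFactor, stack_mul_transpose]
  simp only [hp, hq, if_true]
  push_cast
  exact mul_self_nonneg _

/-- The factors in the box for which some `corr` over `S` vanishes. They contain the part of the
boundary of every sign cell lying in the box. -/
def degenerateSet (S : Finset (Fin (n / r))) : Set (Matrix (Fin n) (Fin r) ℝ) :=
  box n r ∩ {X | ∏ x : S × S × Fin r, corr X x.1.1 x.2.1.1 x.2.2 = 0}

theorem isCompact_degenerateSet (S : Finset (Fin (n / r))) :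
    IsCompact (degenerateSet S : Set (Matrix (Fin n) (Fin r) ℝ)) :=
  isCompact_box.inter_right <|
    isClosed_eq (continuous_finsetProd _ fun _ _ => continuous_corr _ _ _) continuous_const

/-- The value of `W` is zero at `ε = 0`, where it is positive on the compact degenerate set, so the
inequality persists. -/
theorem eventually_objective_lt_of_mem_degenerateSet (S : Finset (Fin (n / r)))
    {W : Matrix (Fin n) (Fin r) ℝ} (hW : (problem S 0).objective W = 0) :
    ∀ᶠ ε in 𝓝 (0 : ℝ), ∀ X ∈ degenerateSet S,
      (problem S ε).objective W < (problem S ε).objective X := by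
  refine (isCompact_degenerateSet S).eventually_forall_of_forall_eventually fun X hX => ?_
  have hWcont : Continuous fun z : ℝ × Matrix (Fin n) (Fin r) ℝ => (problem S z.1).objective W :=
    continuous_objective S continuous_fst continuous_const
  have hpos : (problem S 0).objective W < (problem S 0).objective X := by
    rw [hW]
    refine (objective_nonneg _ _).lt_of_ne' fun h0 => ?_
    obtain ⟨x, -, hx⟩ := Finset.prod_eq_zero_iff.1 hX.2
    exact corr_ne_zero_of_objective_eq_zero h0 x.1.2 x.2.1.2 _ hx
  have hcont : Continuous fun z : ℝ × Matrix (Fin n) (Fin r) ℝ => (problem S z.1).objective z.2 :=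
    continuous_objective S continuous_fst continuous_snd
  exact hWcont.continuousAt.eventually_lt hcont.continuousAt hpos

/-- For small `ε`, every sign pattern is realized by a local minimum. -/
theorem eventually_exists_isLocalMin (S : Finset (Fin (n / r))) :
    ∀ᶠ ε in 𝓝 (0 : ℝ), ∀ σ : Fin (n / r) → Fin r → ℤˣ, ∃ X : Matrix (Fin n) (Fin r) ℝ,
      IsLocalMin (problem S ε).objective X ∧
        ∀ p ∈ S, ∀ q ∈ S, ∀ a, 0 < ((σ p a * σ q a : ℤˣ) : ℝ) * corr X p q a := by
  refine eventually_all.2 fun σ => ?_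
  obtain ⟨W, hW0, hWcell⟩ : ∃ W : Matrix (Fin n) (Fin r) ℝ,
      (problem S 0).objective W = 0 ∧ W ∈ signCell S σ :=
    ⟨signFactor S σ, objective_signFactor S σ, signFactor_mem_signCell S σ⟩
  have hWcont : Continuous fun ε : ℝ => (problem S ε).objective W :=
    continuous_objective S continuous_id continuous_const
  have hsmall : ∀ᶠ ε in 𝓝 (0 : ℝ), (problem S ε).objective W < 1 :=
    hWcont.continuousAt.eventually_lt continuousAt_const (by rw [hW0]; exact one_pos)
  have hone : ∀ᶠ ε in 𝓝 (0 : ℝ), |ε| ≤ 1 :=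
    continuous_abs.continuousAt.eventually (ge_mem_nhds (by simp))
  filter_upwards [eventually_objective_lt_of_mem_degenerateSet S hW0, hsmall, hone]
    with ε hbdry hsmall hone
  have hWmem : W ∈ box n r ∩ signCell S σ := ⟨mem_box_of_objective_lt hone hsmall, hWcell⟩
  have hfcont : Continuous (problem S ε : MCProblem n r).objective :=
    continuous_objective S continuous_const continuous_id
  obtain ⟨X, hXmem, hXmin⟩ := (isCompact_box.inter_right (isClosed_signCell S σ)).exists_isMinOn
    ⟨W, hWmem⟩ hfcont.continuousOn
  have hXW : (problem S ε).objective X ≤ (problem S ε).objective W := hXmin hWmem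
  have hpos : ∀ p ∈ S, ∀ q ∈ S, ∀ a, 0 < ((σ p a * σ q a : ℤˣ) : ℝ) * corr X p q a := by
    intro p hp q hq a
    have hσ : ((σ p a * σ q a : ℤˣ) : ℝ) ≠ 0 := Int.cast_ne_zero.2 (Units.ne_zero _)
    refine (hXmem.2 p hp q hq a).lt_of_ne' (mul_ne_zero hσ fun h0 => ?_)
    have hX : X ∈ degenerateSet S :=
      ⟨hXmem.1, Finset.prod_eq_zero (Finset.mem_univ (⟨p, hp⟩, ⟨q, hq⟩, a)) h0⟩
    exact (hbdry X hX).not_ge hXW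
  refine ⟨X, IsMinOn.isLocalMin (s := signCell S σ) (fun Y hY => ?_) (signCell_mem_nhds hpos), hpos⟩
  rcases lt_or_ge ((problem S ε).objective Y) 1 with h | h
  · exact hXmin ⟨mem_box_of_objective_lt hone h, hY⟩
  · exact (hXW.trans hsmall.le).trans h

/-- A local minimum whose signs are not constant along `S` is spurious: the value zero of the ground
truth factor would force all `corr` over `S` to be `1`. -/
theorem isSpurious_of_signs {S : Finset (Fin (n / r))} {o : Fin (n / r)} (ho : o ∉ S) {ε : ℝ}
    (hε : ε ≠ 0) {σ : Fin (n / r) → Fin r → ℤˣ} {X : Matrix (Fin n) (Fin r) ℝ}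
    (hmin : IsLocalMin (problem S ε).objective X)
    (hpos : ∀ p ∈ S, ∀ q ∈ S, ∀ a, 0 < ((σ p a * σ q a : ℤˣ) : ℝ) * corr X p q a)
    {p q : Fin (n / r)} (hp : p ∈ S) (hq : q ∈ S) {a : Fin r} (hne : σ p a ≠ σ q a) :
    (problem S ε).IsSpurious X := by
  refine ⟨hmin, stack (scale S ε), ?_⟩
  rw [(objective_eq_zero_iff (problem S ε) (stack (scale S ε))).2 fun _ _ _ => rfl]
  refine (objective_nonneg _ _).lt_of_ne' fun h0 => ?_
  have h := hpos p hp q hq a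
  rw [corr_eq_one_of_objective_eq_zero ho hε h0 hp hq, mul_one] at h
  have hneg : σ p a * σ q a = -1 := by
    rcases Int.units_eq_one_or (σ p a) with h1 | h1 <;>
      rcases Int.units_eq_one_or (σ q a) with h2 | h2 <;> simp_all
  rw [hneg] at h
  norm_num at h

/-! ### Counting equivalence classes -/

theorem corr_eq_of_equiv {X Y : Matrix (Fin n) (Fin r) ℝ} (h : factorSetoid n r X Y)
    (p q : Fin (n / r)) (a : Fin r) : corr Y p q a = corr X p q a := by
  obtain ⟨Q, hQ, rfl⟩ := h
  have hQ' : Q * Qᵀ = 1 := (Matrix.mem_orthogonalGroup_iff (Fin r) ℝ).1 hQ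
  rw [corr, corr, Matrix.transpose_mul, Matrix.mul_assoc, ← Matrix.mul_assoc Q, hQ', Matrix.one_mul]

theorem units_eq_of_mul_pos {u v : ℤˣ} {c : ℝ} (hu : 0 < ((u : ℤˣ) : ℝ) * c)
    (hv : 0 < ((v : ℤˣ) : ℝ) * c) : u = v := by
  rcases Int.units_eq_one_or u with rfl | rfl <;> rcases Int.units_eq_one_or v with rfl | rfl <;>
    first
    | rfl
    | (exfalso; simp at hu hv; linarith)

/-- Sign patterns on the members of `S` other than `p₀`, extended by `1`, give inequivalent local
minima, all spurious except for the pattern `1`. -/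
theorem le_encard_spuriousClasses {S : Finset (Fin (n / r))} {o p₀ : Fin (n / r)} (ho : o ∉ S)
    (hp₀ : p₀ ∈ S) {ε : ℝ} (hε : ε ≠ 0)
    (hloc : ∀ σ : Fin (n / r) → Fin r → ℤˣ, ∃ X : Matrix (Fin n) (Fin r) ℝ,
      IsLocalMin (problem S ε).objective X ∧
        ∀ p ∈ S, ∀ q ∈ S, ∀ a, 0 < ((σ p a * σ q a : ℤˣ) : ℝ) * corr X p q a) :
    ((2 ^ (r * (S.card - 1)) - 1 : ℕ) : ℕ∞) ≤
      (problem S ε : MCProblem n r).spuriousClasses.encard := by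
  let ext' : ({p // p ∈ S.erase p₀} → Fin r → ℤˣ) → Fin (n / r) → Fin r → ℤˣ :=
    fun τ p => if h : p ∈ S.erase p₀ then τ ⟨p, h⟩ else 1
  have hext : ∀ τ (p : {p // p ∈ S.erase p₀}), ext' τ p.1 = τ p := fun τ p => dif_pos p.2
  have hext₀ : ∀ τ, ext' τ p₀ = 1 := fun τ => dif_neg (Finset.notMem_erase p₀ S)
  choose X hmin hpos using fun τ => hloc (ext' τ)
  let F : {τ : {p // p ∈ S.erase p₀} → Fin r → ℤˣ // τ ≠ 1} → Quotient (factorSetoid n r) :=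
    fun τ => Quotient.mk _ (X τ.1)
  have hF : Function.Injective F := by
    intro τ τ' h
    have hX : factorSetoid n r (X τ.1) (X τ'.1) := Quotient.exact h
    refine Subtype.ext (funext fun p => funext fun a => ?_)
    have hp : p.1 ∈ S := Finset.mem_of_mem_erase p.2
    have h1 := hpos τ.1 p.1 hp p₀ hp₀ a
    have h2 := hpos τ'.1 p.1 hp p₀ hp₀ a
    rw [corr_eq_of_equiv hX] at h2
    simpa [hext, hext₀] using units_eq_of_mul_pos h1 h2
  have hsub : Set.range F ⊆ (problem S ε : MCProblem n r).spuriousClasses := by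
    rintro _ ⟨τ, rfl⟩
    obtain ⟨p, hp⟩ := Function.ne_iff.1 τ.2
    obtain ⟨a, ha⟩ := Function.ne_iff.1 hp
    refine ⟨X τ.1, isSpurious_of_signs ho hε (hmin τ.1) (hpos τ.1)
      (Finset.mem_of_mem_erase p.2) hp₀ (a := a) ?_, rfl⟩
    rw [hext, hext₀]
    exact ha
  have hcard : Fintype.card {τ : {p // p ∈ S.erase p₀} → Fin r → ℤˣ // τ ≠ 1} =
      2 ^ (r * (S.card - 1)) - 1 := by
    rw [Fintype.card_subtype_compl, Fintype.card_subtype_eq, Fintype.card_fun,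
      Fintype.card_fun, Fintype.card_units_int, Fintype.card_coe, Fintype.card_fin,
      Finset.card_erase_of_mem hp₀, pow_mul]
  calc ((2 ^ (r * (S.card - 1)) - 1 : ℕ) : ℕ∞) = ENat.card {τ : {p // p ∈ S.erase p₀} → Fin r → ℤˣ // τ ≠ 1} := by
        rw [ENat.card_eq_coe_fintype_card, hcard]
    _ ≤ (Set.range F).encard := hF.encard_range
    _ ≤ _ := Set.encard_le_encard hsub

end CompletionInstance

open CompletionInstance in
theorem corollary3 (n r : ℕ) (hr : 1 ≤ r) (hn : 2 * r ≤ n) :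
    (∃ (G : BlockSparsityGraph (n / r)) (P : MCProblem n r), LowComplexity G P ∧
      ((2 ^ (r * (n / r) - 2 * r) - 1 : ℕ) : ℕ∞) ≤ P.spuriousClasses.encard) ∧
    (3 * r ≤ n → ∃ (G : BlockSparsityGraph (n / r)) (P : MCProblem n r), LowComplexity G P ∧
      P.observed.ncard = n ^ 2 - 2 * r ∧
      ∃ X : Matrix (Fin n) (Fin r) ℝ, P.IsSpurious X) := by
  have hsmall : ∀ S : Finset (Fin (n / r)), ∃ ε : ℝ, ε ≠ 0 ∧
      ∀ σ : Fin (n / r) → Fin r → ℤˣ, ∃ X : Matrix (Fin n) (Fin r) ℝ,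
        IsLocalMin (problem S ε).objective X ∧
          ∀ p ∈ S, ∀ q ∈ S, ∀ a, 0 < ((σ p a * σ q a : ℤˣ) : ℝ) * corr X p q a := by
    intro S
    obtain ⟨ε, hloc, hε⟩ :=
      (((eventually_exists_isLocalMin S).filter_mono nhdsWithin_le_nhds).and
        (self_mem_nhdsWithin : {0}ᶜ ∈ 𝓝[≠] (0 : ℝ))).exists
    exact ⟨ε, hε, hloc⟩
  constructor
  · have hm : 2 ≤ n / r := (Nat.le_div_iff_mul_le hr).2 hn
    let o : Fin (n / r) := ⟨0, by omega⟩
    let p₀ : Fin (n / r) := ⟨1, by omega⟩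
    let S : Finset (Fin (n / r)) := Finset.univ.erase o
    have ho : o ∉ S := Finset.notMem_erase _ _
    have hp₀ : p₀ ∈ S := Finset.mem_erase.2 ⟨by simp [o, p₀], Finset.mem_univ _⟩
    obtain ⟨ε, hε, hloc⟩ := hsmall S
    refine ⟨graph S, problem S ε, lowComplexity ho hε, ?_⟩
    have h := le_encard_spuriousClasses ho hp₀ hε hloc
    have hcard : S.card - 1 = n / r - 2 := by
      rw [Finset.card_erase_of_mem (Finset.mem_univ o), Finset.card_univ, Fintype.card_fin]
      omega
    rwa [hcard, Nat.mul_sub, Nat.mul_comm r 2] at h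
  · intro hn3
    have hm : 3 ≤ n / r := (Nat.le_div_iff_mul_le hr).2 hn3
    let p : Fin (n / r) := ⟨0, by omega⟩
    let q : Fin (n / r) := ⟨1, by omega⟩
    let o : Fin (n / r) := ⟨2, by omega⟩
    have hpq : p ≠ q := by simp [p, q]
    let S : Finset (Fin (n / r)) := {p, q}
    have hp : p ∈ S := by simp [S]
    have hq : q ∈ S := by simp [S]
    have ho : o ∉ S := by simp [S, o, p, q]
    obtain ⟨ε, hε, hloc⟩ := hsmall S
    refine ⟨graph S, problem S ε, lowComplexity ho hε, ?_, ?_⟩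
    · rw [ncard_observed, Finset.card_pair hpq]
    · obtain ⟨X, hmin, hpos⟩ := hloc fun x _ => if x = p then 1 else -1
      refine ⟨X, isSpurious_of_signs ho hε hmin hpos hp hq (a := ⟨0, hr⟩) ?_⟩
      rw [if_pos rfl, if_neg hpq.symm]
      decide
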